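/- Let $q=2^r$ with $r\geq 1$, let $\mathbb{F}_q$ be the field with $q$ elements, and let $n\ge 1$. Let $O^+(2n,q)\subset GL(2n,q)$ be the group of all isometries of the quadratic form $\theta^+(x)=\sum_{k=1}^{n}x_kx_{n+k}$ on $\mathbb{F}_q^{2n}$, and let $$P^+=P^+(2n,q)=\left\{\begin{bmatrix}A&0\\0&{}^tA^{-1}\end{bmatrix}\begin{bmatrix}1_n&B\\0&1_n\end{bmatrix}\ :\ A\in GL(n,q),\ B\in\mathbb{F}_q^{n\times n}\ \text{alternating}\right\},$$ where $B=(b_{kl})$ is called alternating if $b_{kk}=0$ and $b_{kl}=-b_{lk}$ for all $k,l$. For $0\le s\le n$ let $$\sigma_s^+=\begin{bmatrix}0&0&1_s&0\\0&1_{n-s}&0&0\\1_s&0&0&0\\0&0&0&1_{n-s}\end{bmatrix}\in O^+(2n,q).$$ Put $DC_1^{\pm}(n,q)=P^+\sigma_{n-1}^+P^+$ and $DC_2^{\pm}(n,q)=P^+\sigma_{n-2}^+P^+$, where $DC_1^+(n,q)$ and $DC_2^+(n,q)$ are considered for $n=2,4,6,\dots$, $DC_1^-(n,q)$ for $n=1,3,5,\dots$,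 and $DC_2^-(n,q)$ for $n=3,5,7,\dots$. Let $N_i^{\pm}(n,q)=|DC_i^{\pm}(n,q)|$, let $g_1,\dots,g_N$ with $N=N_i^{\pm}(n,q)$ be any fixed ordering of the elements of $DC_i^{\pm}(n,q)$, put $v_i^{\pm}(n,q)=(\mathrm{Tr}\,g_1,\dots,\mathrm{Tr}\,g_N)\in\mathbb{F}_q^{N}$, where $\mathrm{Tr}$ denotes the matrix trace, and define the binary linear code $$C(DC_i^{\pm}(n,q))=\{u\in\mathbb{F}_2^{N}\ :\ u\cdot v_i^{\pm}(n,q)=0\},$$ where the dot is the usual inner product in $\mathbb{F}_q^{N}$. Let $C_{i,j}^{\pm}(n,q)$ be the number of codewords of Hamming weight $j$ in $C(DC_i^{\pm}(n,q))$. Then, for $i=1,2$, for each sign and all $n$ as above, and for all $q$, $$C_{i,j}^{\pm}(n,q)=C_{i,N_i^{\pm}(n,q)-j}^{\pm}(n,q)\qquad\text{for all } j \text{ with } 0\le j\le N_i^{\pm}(n,q).$$ -/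

import Mathlib

namespace DoubleCosetCode

section Groups

/-- A square matrix is alternating if its diagonal vanishes and `a i j = - a j i`. -/
def IsAlternating {n : ℕ} {F : Type*} [Field F] (B : Matrix (Fin n) (Fin n) F) : Prop :=
  (∀ i, B i i = 0) ∧ ∀ i j, B i j = -B j i

/-- The quadratic form `θ⁺(x) = ∑ i, x_i x_{n+i}` on the space of column vectors of length `2n`.
The index set `{1, …, 2n}` is written as `Fin n ⊕ Fin n`. -/
noncomputable def theta (n : ℕ) (F : Type*) [Field F] : QuadraticForm F (Fin n ⊕ Fin n → F) :=
  ∑ i : Fin n, QuadraticMap.linMulLin (LinearMap.proj (Sum.inl i)) (LinearMap.proj (Sum.inr i))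

theorem theta_apply {n : ℕ} {F : Type*} [Field F] (x : Fin n ⊕ Fin n → F) :
    theta n F x = ∑ i : Fin n, x (Sum.inl i) * x (Sum.inr i) := by
  simp [theta]

theorem theta_elim {n : ℕ} {F : Type*} [Field F] (y z : Fin n → F) :
    theta n F (Sum.elim y z) = y ⬝ᵥ z := by
  simp [theta_apply, dotProduct]

/-- `O⁺(2n, F)`: the group of all isometries of `θ⁺`, as a subgroup of `GL(2n, F)`. -/
def orthogonalPlus (n : ℕ) (F : Type*) [Field F] : Subgroup (GL (Fin n ⊕ Fin n) F) where
  carrier := {w | ∀ x : Fin n ⊕ Fin n → F,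
    theta n F ((w : Matrix (Fin n ⊕ Fin n) (Fin n ⊕ Fin n) F).mulVec x) = theta n F x}
  one_mem' := by intro x; simp
  mul_mem' := by
    intro a b ha hb x
    rw [Units.val_mul, ← Matrix.mulVec_mulVec, ha, hb]
  inv_mem' := by
    intro a ha x
    rw [← ha, Matrix.mulVec_mulVec, ← Units.val_mul, mul_inv_cancel, Units.val_one,
      Matrix.one_mulVec]

theorem IsAlternating.dotProduct_mulVec_self {n : ℕ} {F : Type*} [Field F]
    {B : Matrix (Fin n) (Fin n) F} (hB : IsAlternating B) (x : Fin n → F) :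
    x ⬝ᵥ B.mulVec x = 0 := by
  simp only [dotProduct, Matrix.mulVec, Finset.mul_sum]
  rw [← Finset.sum_product']
  refine Finset.sum_involution (fun p _ => (p.2, p.1)) ?_ ?_ (by simp) (by simp)
  · rintro ⟨i, j⟩ -
    simp only
    rw [hB.2 i j]
    ring
  · rintro ⟨i, j⟩ - h he
    obtain rfl : j = i := congrArg Prod.fst he
    exact h (by simp [hB.1])

theorem IsAlternating.add {n : ℕ} {F : Type*} [Field F] {B C : Matrix (Fin n) (Fin n) F}
    (hB : IsAlternating B) (hC : IsAlternating C) : IsAlternating (B + C) :=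
  ⟨fun i => by simp [hB.1, hC.1], fun i j => by
    rw [Matrix.add_apply, Matrix.add_apply, hB.2, hC.2]; ring⟩

theorem IsAlternating.neg {n : ℕ} {F : Type*} [Field F] {B : Matrix (Fin n) (Fin n) F}
    (hB : IsAlternating B) : IsAlternating (-B) :=
  ⟨fun i => by simp [hB.1], fun i j => by rw [Matrix.neg_apply, Matrix.neg_apply, hB.2]⟩

theorem IsAlternating.congr {n : ℕ} {F : Type*} [Field F] {B : Matrix (Fin n) (Fin n) F}
    (hB : IsAlternating B) (X : Matrix (Fin n) (Fin n) F) :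
    IsAlternating (X * B * X.transpose) := by
  have ht : B.transpose = -B := by
    ext i j
    rw [Matrix.transpose_apply, Matrix.neg_apply, hB.2]
  refine ⟨fun i => ?_, fun i j => ?_⟩
  · have h := hB.dotProduct_mulVec_self (X i)
    rw [Matrix.mul_assoc, Matrix.mul_apply]
    simpa [dotProduct, Matrix.mulVec, Matrix.mul_apply] using h
  · have h : (X * B * X.transpose).transpose = -(X * B * X.transpose) := by
      simp [Matrix.transpose_mul, ht, Matrix.mul_assoc]
    have h' := congrFun (congrFun h j) i
    simpa using h'

/-- The block diagonal matrix `[A, 0; 0, ᵗA⁻¹]`, for `A` in `GL(n, F)`. -/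
def levi {n : ℕ} {F : Type*} [Field F] (A : GL (Fin n) F) : orthogonalPlus n F where
  val :=
    { val := Matrix.fromBlocks (A : Matrix (Fin n) (Fin n) F) 0 0
        ((A⁻¹ : GL (Fin n) F) : Matrix (Fin n) (Fin n) F).transpose
      inv := Matrix.fromBlocks ((A⁻¹ : GL (Fin n) F) : Matrix (Fin n) (Fin n) F) 0 0
        (A : Matrix (Fin n) (Fin n) F).transpose
      val_inv := by
        rw [Matrix.fromBlocks_multiply, ← Matrix.transpose_mul, ← Units.val_mul]
        simp
      inv_val := by
        rw [Matrix.fromBlocks_multiply, ← Matrix.transpose_mul, ← Units.val_mul]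
        simp }
  property := by
    intro x
    obtain ⟨y, z, rfl⟩ : ∃ y z : Fin n → F, x = Sum.elim y z :=
      ⟨x ∘ Sum.inl, x ∘ Sum.inr, (Sum.elim_comp_inl_inr x).symm⟩
    simp only [Matrix.fromBlocks_mulVec, theta_elim, Matrix.zero_mulVec, add_zero, zero_add,
      Sum.elim_comp_inl, Sum.elim_comp_inr]
    rw [Matrix.dotProduct_mulVec, Matrix.vecMul_transpose, Matrix.mulVec_mulVec, ← Units.val_mul,
      inv_mul_cancel, Units.val_one, Matrix.one_mulVec]

/-- The block unipotent matrix `[1, B; 0, 1]`, for `B` alternating. -/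
def unip {n : ℕ} {F : Type*} [Field F] (B : Matrix (Fin n) (Fin n) F) (hB : IsAlternating B) :
    orthogonalPlus n F where
  val :=
    { val := Matrix.fromBlocks 1 B 0 1
      inv := Matrix.fromBlocks 1 (-B) 0 1
      val_inv := by simp [Matrix.fromBlocks_multiply]
      inv_val := by simp [Matrix.fromBlocks_multiply] }
  property := by
    intro x
    obtain ⟨y, z, rfl⟩ : ∃ y z : Fin n → F, x = Sum.elim y z :=
      ⟨x ∘ Sum.inl, x ∘ Sum.inr, (Sum.elim_comp_inl_inr x).symm⟩
    simp only [Matrix.fromBlocks_mulVec, theta_elim, Matrix.zero_mulVec, Matrix.one_mulVec,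
      zero_add, Sum.elim_comp_inl, Sum.elim_comp_inr]
    rw [add_dotProduct, dotProduct_comm (B.mulVec z), hB.dotProduct_mulVec_self, add_zero]

theorem levi_mul {n : ℕ} {F : Type*} [Field F] (A A' : GL (Fin n) F) :
    levi A * levi A' = levi (A * A') := by
  apply Subtype.ext
  apply Units.ext
  simp [levi, Matrix.fromBlocks_multiply, Matrix.transpose_mul]

theorem unip_mul {n : ℕ} {F : Type*} [Field F] (B C : Matrix (Fin n) (Fin n) F)
    (hB : IsAlternating B) (hC : IsAlternating C) :
    unip B hB * unip C hC = unip (B + C) (hB.add hC) := by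
  apply Subtype.ext
  apply Units.ext
  simp [unip, Matrix.fromBlocks_multiply, add_comm]

theorem unip_inv {n : ℕ} {F : Type*} [Field F] (B : Matrix (Fin n) (Fin n) F)
    (hB : IsAlternating B) : (unip B hB)⁻¹ = unip (-B) hB.neg :=
  Subtype.ext (Units.ext rfl)

theorem levi_inv {n : ℕ} {F : Type*} [Field F] (A : GL (Fin n) F) :
    (levi A)⁻¹ = levi A⁻¹ :=
  Subtype.ext (Units.ext (by
    change Matrix.fromBlocks _ _ _ _ = Matrix.fromBlocks _ _ _ _
    rw [inv_inv]))

theorem unip_mul_levi {n : ℕ} {F : Type*} [Field F] (B : Matrix (Fin n) (Fin n) F)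
    (hB : IsAlternating B) (A : GL (Fin n) F) :
    unip B hB * levi A = levi A *
      unip (((A⁻¹ : GL (Fin n) F) : Matrix (Fin n) (Fin n) F) * B *
        ((A⁻¹ : GL (Fin n) F) : Matrix (Fin n) (Fin n) F).transpose) (hB.congr _) := by
  apply Subtype.ext
  apply Units.ext
  change Matrix.fromBlocks _ _ _ _ * Matrix.fromBlocks _ _ _ _ =
    Matrix.fromBlocks _ _ _ _ * Matrix.fromBlocks _ _ _ _
  have h : (A : Matrix (Fin n) (Fin n) F) * ((A⁻¹ : GL (Fin n) F) : Matrix (Fin n) (Fin n) F) = 1 := by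
    rw [← Units.val_mul, mul_inv_cancel, Units.val_one]
  simp only [Matrix.fromBlocks_multiply, ← Matrix.mul_assoc, h]
  simp

/-- The maximal parabolic subgroup `P⁺(2n, F)` of `O⁺(2n, F)`: all products
`[A, 0; 0, ᵗA⁻¹] [1, B; 0, 1]` with `A` in `GL(n, F)` and `B` alternating. -/
def parabolic (n : ℕ) (F : Type*) [Field F] : Subgroup (orthogonalPlus n F) where
  carrier := {w | ∃ (A : GL (Fin n) F) (B : Matrix (Fin n) (Fin n) F) (hB : IsAlternating B),
    w = levi A * unip B hB}
  one_mem' := by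
    refine ⟨1, 0, ⟨fun _ => rfl, fun _ _ => by simp⟩, ?_⟩
    apply Subtype.ext
    apply Units.ext
    simp [levi, unip]
  mul_mem' := by
    rintro _ _ ⟨A, B, hB, rfl⟩ ⟨A', B', hB', rfl⟩
    exact ⟨A * A', _, (hB.congr ((A'⁻¹ : GL (Fin n) F) : Matrix (Fin n) (Fin n) F)).add hB', by
      rw [mul_assoc, ← mul_assoc (unip B hB), unip_mul_levi, ← levi_mul, ← unip_mul _ _ (hB.congr _) hB']
      simp only [mul_assoc]⟩
  inv_mem' := by
    rintro _ ⟨A, B, hB, rfl⟩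
    exact ⟨A⁻¹, _, hB.neg.congr _, by
      rw [mul_inv_rev, unip_inv, levi_inv, unip_mul_levi]⟩

/-- The element `σ_r⁺` of `O⁺(2n, F)`: the permutation matrix that interchanges the `i`-th and the
`(n+i)`-th coordinate for each of the first `r` indices `i`, and fixes the other coordinates. -/
def sigma (n r : ℕ) (F : Type*) [Field F] : orthogonalPlus n F where
  val :=
    { val := Matrix.fromBlocks
        (Matrix.diagonal fun i : Fin n => if (i : ℕ) < r then 0 else 1)
        (Matrix.diagonal fun i : Fin n => if (i : ℕ) < r then 1 else 0)
        (Matrix.diagonal fun i : Fin n => if (i : ℕ) < r then 1 else 0)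
        (Matrix.diagonal fun i : Fin n => if (i : ℕ) < r then 0 else 1)
      inv := Matrix.fromBlocks
        (Matrix.diagonal fun i : Fin n => if (i : ℕ) < r then 0 else 1)
        (Matrix.diagonal fun i : Fin n => if (i : ℕ) < r then 1 else 0)
        (Matrix.diagonal fun i : Fin n => if (i : ℕ) < r then 1 else 0)
        (Matrix.diagonal fun i : Fin n => if (i : ℕ) < r then 0 else 1)
      val_inv := by
        rw [Matrix.fromBlocks_multiply, ← Matrix.fromBlocks_one]
        simp only [Matrix.diagonal_mul_diagonal, Matrix.diagonal_add]
        congr 1 <;> ext i j <;> by_cases h : (i : ℕ) < r <;> simp [Matrix.diagonal_apply, h, Matrix.one_apply]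
      inv_val := by
        rw [Matrix.fromBlocks_multiply, ← Matrix.fromBlocks_one]
        simp only [Matrix.diagonal_mul_diagonal, Matrix.diagonal_add]
        congr 1 <;> ext i j <;> by_cases h : (i : ℕ) < r <;> simp [Matrix.diagonal_apply, h, Matrix.one_apply] }
  property := by
    intro x
    rw [theta_apply, theta_apply]
    refine Finset.sum_congr rfl fun i _ => ?_
    by_cases h : (i : ℕ) < r <;>
      simp [Matrix.fromBlocks_mulVec, Matrix.mulVec_diagonal, h, mul_comm]

/-- The double coset `DC_i^±(n, F) = P⁺ σ_{n-i}⁺ P⁺` in `O⁺(2n, F)`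
(the sign is that of `(-1)^n`, so it is determined by `n`). -/
def DC (i n : ℕ) (F : Type*) [Field F] : Set (orthogonalPlus n F) :=
  DoubleCoset.doubleCoset (sigma n (n - i) F)
    (parabolic n F : Set (orthogonalPlus n F)) (parabolic n F : Set (orthogonalPlus n F))

/-- `N_i^±(n, F)`, the number of elements of the double coset. -/
noncomputable def N (i n : ℕ) (F : Type*) [Field F] : ℕ :=
  Nat.card (DC i n F)

end Groups

section Codes

/-- For an ordering `g` of the elements of the double coset, the vector
`v = (Tr g_1, …, Tr g_N)` over `F`. -/
def traceVector {i n : ℕ} {F : Type*} [Field F] (g : Fin (N i n F) ≃ DC i n F) :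
    Fin (N i n F) → F :=
  fun k => Matrix.trace
    (((g k : orthogonalPlus n F) : GL (Fin n ⊕ Fin n) F) : Matrix (Fin n ⊕ Fin n) (Fin n ⊕ Fin n) F)

/-- The binary linear code of all `u` over the field with two elements with `u · v = 0`, where
`v` is the vector of traces and the inner product is taken in `F`. -/
def code {i n : ℕ} {F : Type*} [Field F] [Algebra (ZMod 2) F] (g : Fin (N i n F) ≃ DC i n F) :
    Submodule (ZMod 2) (Fin (N i n F) → ZMod 2) where
  carrier := {u | (fun k => algebraMap (ZMod 2) F (u k)) ⬝ᵥ traceVector g = 0}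
  zero_mem' := by simp [dotProduct]
  add_mem' := by
    intro a b ha hb
    simp only [Set.mem_ofPred_eq, dotProduct, Pi.add_apply, map_add, add_mul,
      Finset.sum_add_distrib] at *
    rw [ha, hb, add_zero]
  smul_mem' := by
    intro c a ha
    simp only [Set.mem_ofPred_eq, dotProduct, Pi.smul_apply, smul_eq_mul, map_mul, mul_assoc,
      ← Finset.mul_sum] at *
    rw [ha, mul_zero]

/-- The weight distribution of a binary code `C` of length `m`: the number of codewords of
Hamming weight `j`. -/
noncomputable def weightDistribution {m : ℕ} (C : Submodule (ZMod 2) (Fin m → ZMod 2)) (j : ℕ) :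
    ℕ :=
  Nat.card {u : Fin m → ZMod 2 // u ∈ C ∧ hammingNorm u = j}

end Codes

end DoubleCosetCode

namespace DoubleCosetCode

/-! The all-ones word lies in the code exactly when the traces over the double coset sum to zero,
and adding that word then pairs weight `j` with weight `N - j` (`weightDistribution_symm`). For `n ≥
2` the sum `S` of all matrices in the double coset is fixed by left multiplication by the parabolic
subgroup. Already the transvections in its Levi factor force the diagonal of `S` to vanish
(`trace_eq_zero_of_levi_mul_eq`), in any characteristic. The one remaining case is `n = i = 1`.
There the double coset is the parabolic subgroup itself, and inversion together with characteristic
2 cancels the sum (`sum_trace_DC_self`). -/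

/-- A binary linear code that contains the all-ones word has a symmetric weight distribution. -/
theorem weightDistribution_symm {m : ℕ} (C : Submodule (ZMod 2) (Fin m → ZMod 2))
    (hC : (1 : Fin m → ZMod 2) ∈ C) {j : ℕ} (hj : j ≤ m) :
    weightDistribution C j = weightDistribution C (m - j) := by
  -- Over the field with two elements, adding 1 exchanges the zeros of `u` with its support.
  have hnorm (u : Fin m → ZMod 2) : hammingNorm (u + 1) + hammingNorm u = m := by
    have h := Finset.card_filter_add_card_filter_not (s := Finset.univ) (fun k => u k = 0)
    rw [Finset.card_univ, Fintype.card_fin] at h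
    have h1 (a : ZMod 2) : a + 1 ≠ 0 ↔ a = 0 := by revert a; decide
    simpa only [hammingNorm, Pi.add_apply, Pi.one_apply, h1] using h
  have hinv (u : Fin m → ZMod 2) : u + 1 + 1 = u := by
    ext k
    simp [add_assoc, CharTwo.add_self_eq_zero]
  refine Nat.card_congr
    { toFun := fun u => ⟨u + 1, C.add_mem u.2.1 hC, by have := hnorm u; have := u.2.2; omega⟩
      -- Here `hj` is needed, since `m - j` is a truncated subtraction.
      invFun := fun u => ⟨u + 1, C.add_mem u.2.1 hC, by have := hnorm u; have := u.2.2; omega⟩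
      left_inv := fun u => Subtype.ext (hinv u)
      right_inv := fun u => Subtype.ext (hinv u) }

variable {i n : ℕ} {F : Type*} [Field F]

/-- The matrix underlying an element of `O⁺(2n, F)`. -/
abbrev toMat (w : orthogonalPlus n F) : Matrix (Fin n ⊕ Fin n) (Fin n ⊕ Fin n) F :=
  ((w : GL (Fin n ⊕ Fin n) F) : Matrix (Fin n ⊕ Fin n) (Fin n ⊕ Fin n) F)

theorem levi_mem_parabolic (A : GL (Fin n) F) : levi A ∈ parabolic n F :=
  ⟨A, 0, ⟨fun _ => rfl, fun _ _ => by simp⟩, by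
    apply Subtype.ext
    apply Units.ext
    simp [levi, unip]⟩

theorem parabolic_mul_mem_DC {p w : orthogonalPlus n F} (hp : p ∈ parabolic n F)
    (hw : w ∈ DC i n F) : p * w ∈ DC i n F := by
  rw [DC, DoubleCoset.mem_doubleCoset] at hw ⊢
  obtain ⟨x, hx, y, hy, rfl⟩ := hw
  exact ⟨p * x, mul_mem hp hx, y, hy, by simp only [mul_assoc]⟩

/-- Left translation of a double coset by an element of the parabolic subgroup. -/
def translateDC (i : ℕ) {p : orthogonalPlus n F} (hp : p ∈ parabolic n F) :
    DC i n F ≃ DC i n F where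
  toFun w := ⟨p * w, parabolic_mul_mem_DC hp w.2⟩
  invFun w := ⟨p⁻¹ * w, parabolic_mul_mem_DC (inv_mem hp) w.2⟩
  left_inv w := Subtype.ext (inv_mul_cancel_left p (w : orthogonalPlus n F))
  right_inv w := Subtype.ext (mul_inv_cancel_left p (w : orthogonalPlus n F))

/-- Left translation by `p` only permutes the summands. -/
theorem toMat_mul_sum {ι : Type*} [Fintype ι] (g : ι ≃ DC i n F) {p : orthogonalPlus n F}
    (hp : p ∈ parabolic n F) :
    toMat p * ∑ k, toMat (g k : orthogonalPlus n F) =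
      ∑ k, toMat (g k : orthogonalPlus n F) := by
  rw [Finset.mul_sum, ← Equiv.sum_comp ((g.trans (translateDC i hp)).trans g.symm)
    fun k => toMat (g k : orthogonalPlus n F)]
  simp [translateDC, toMat]

/-- The transvection `1 + E_ab` as an element of `GL(n, F)`. -/
def transvectionGL (a b : Fin n) (hab : a ≠ b) : GL (Fin n) F where
  val := Matrix.transvection a b 1
  inv := Matrix.transvection a b (-1)
  val_inv := by rw [Matrix.transvection_mul_transvection_same _ _ hab]; simp
  inv_val := by rw [Matrix.transvection_mul_transvection_same _ _ hab]; simp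

theorem coe_inv_transvectionGL (a b : Fin n) (hab : a ≠ b) :
    (((transvectionGL a b hab)⁻¹ : GL (Fin n) F) : Matrix (Fin n) (Fin n) F) =
      Matrix.transvection a b (-1) :=
  rfl

theorem trace_eq_zero_of_levi_mul_eq (hn : 2 ≤ n)
    {S : Matrix (Fin n ⊕ Fin n) (Fin n ⊕ Fin n) F}
    (hS : ∀ A : GL (Fin n) F, toMat (levi A) * S = S) : S.trace = 0 := by
  have : Nontrivial (Fin n) := Fin.nontrivial_iff_two_le.2 hn
  have key (A : GL (Fin n) F) :
      (A : Matrix (Fin n) (Fin n) F) * S.toBlocks₁₁ = S.toBlocks₁₁ ∧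
      ((A⁻¹ : GL (Fin n) F) : Matrix (Fin n) (Fin n) F).transpose * S.toBlocks₂₂ =
        S.toBlocks₂₂ := by
    have h := hS A
    rw [← Matrix.fromBlocks_toBlocks S] at h
    simp only [toMat, levi, Matrix.fromBlocks_multiply, Matrix.zero_mul, add_zero, zero_add] at h
    rw [Matrix.fromBlocks_inj] at h
    exact ⟨h.1, h.2.2.2⟩
  have h1 (b : Fin n) : S (.inl b) (.inl b) = 0 := by
    obtain ⟨a, hab⟩ := exists_ne b
    have h := congrFun (congrFun (key (transvectionGL a b hab)).1 a) b
    -- With `X` the upper left block, the `(a, b)` entry of `(1 + E_ab) X = X` reads `X_ab + X_bb =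
    -- X_ab`.
    simpa [transvectionGL, Matrix.transvection, Matrix.add_mul, Matrix.toBlocks₁₁] using h
  have h2 (b : Fin n) : S (.inr b) (.inr b) = 0 := by
    obtain ⟨a, hab⟩ := exists_ne b
    -- The indices are swapped because the lower block of `levi` is an inverse transpose: `1 + E_ba`
    -- acts there as `1 - E_ab`.
    have h := congrFun (congrFun (key (transvectionGL b a hab.symm)).2 a) b
    rw [coe_inv_transvectionGL] at h
    simpa [Matrix.transvection, Matrix.add_mul,
      Matrix.toBlocks₂₂] using h
  simp [Matrix.trace, Fintype.sum_sum_type, h1, h2]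

theorem sigma_zero : sigma n 0 F = 1 := by
  apply Subtype.ext
  apply Units.ext
  simp [sigma]

theorem mem_DC_self {w : orthogonalPlus n F} : w ∈ DC n n F ↔ w ∈ parabolic n F := by
  rw [DC, Nat.sub_self, sigma_zero, DoubleCoset.mem_doubleCoset]
  constructor
  · rintro ⟨x, hx, y, hy, rfl⟩
    rw [mul_one]
    exact mul_mem hx hy
  · exact fun hw => ⟨w, hw, 1, one_mem _, by simp⟩

/-- Inversion on the double coset of the identity, that is, on the parabolic subgroup. -/
def invDC (n : ℕ) (F : Type*) [Field F] : DC n n F ≃ DC n n F where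
  toFun w := ⟨(w : orthogonalPlus n F)⁻¹, mem_DC_self.2 (inv_mem (mem_DC_self.1 w.2))⟩
  invFun w := ⟨(w : orthogonalPlus n F)⁻¹, mem_DC_self.2 (inv_mem (mem_DC_self.1 w.2))⟩
  left_inv w := Subtype.ext (inv_inv (w : orthogonalPlus n F))
  right_inv w := Subtype.ext (inv_inv (w : orthogonalPlus n F))

/-- The trace of an element of the parabolic subgroup is the sum of the traces of the upper left
blocks of the element and of its inverse. -/
theorem trace_of_mem_parabolic {w : orthogonalPlus n F} (hw : w ∈ parabolic n F) :
    (toMat w).trace = (toMat w).toBlocks₁₁.trace + (toMat w⁻¹).toBlocks₁₁.trace := by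
  obtain ⟨A, B, hB, rfl⟩ := hw
  -- The inverse has upper left block `A⁻¹`, with the same trace as the lower right block `ᵗA⁻¹` of
  -- the element.
  rw [mul_inv_rev, levi_inv, unip_inv]
  simp [toMat, levi, unip, Matrix.fromBlocks_multiply, Matrix.trace, Fintype.sum_sum_type]

/-- Inversion permutes the subgroup, so the two sums of upper left traces coincide and their total
is twice one of them. -/
theorem sum_trace_DC_self [CharP F 2] {ι : Type*} [Fintype ι] (g : ι ≃ DC n n F) :
    ∑ k, (toMat (g k : orthogonalPlus n F)).trace = 0 := by
  have hmem (k : ι) : (g k : orthogonalPlus n F) ∈ parabolic n F :=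
    mem_DC_self.1 (g k).2
  simp only [fun k => trace_of_mem_parabolic (hmem k), Finset.sum_add_distrib]
  rw [← Equiv.sum_comp ((g.trans (invDC n F)).trans g.symm)
    fun k => (toMat (g k : orthogonalPlus n F)).toBlocks₁₁.trace]
  simp [invDC, CharTwo.add_self_eq_zero]

theorem sum_trace_DC [CharP F 2] {ι : Type*} [Fintype ι] (g : ι ≃ DC i n F)
    (hin : 2 ≤ n ∨ i = n) : ∑ k, (toMat (g k : orthogonalPlus n F)).trace = 0 := by
  rcases hin with hn | rfl
  · rw [← Matrix.trace_sum]
    exact trace_eq_zero_of_levi_mul_eq hn fun A => toMat_mul_sum g (levi_mem_parabolic A)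
  · exact sum_trace_DC_self g

end DoubleCosetCode

theorem corollary17 (r q : ℕ) (hr : 0 < r) (hq : q = 2 ^ r)
    (F : Type*) [Field F] [Fintype F] [Algebra (ZMod 2) F] (hF : Fintype.card F = q)
    (i n : ℕ)
    (hin : (i = 1 ∧ Even n ∧ 2 ≤ n) ∨ (i = 2 ∧ Even n ∧ 2 ≤ n) ∨
      (i = 1 ∧ Odd n ∧ 1 ≤ n) ∨ (i = 2 ∧ Odd n ∧ 3 ≤ n))
    (g : Fin (DoubleCosetCode.N i n F) ≃ DoubleCosetCode.DC i n F)
    (j : ℕ) (hj : j ≤ DoubleCosetCode.N i n F) :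
    DoubleCosetCode.weightDistribution (DoubleCosetCode.code g) j =
      DoubleCosetCode.weightDistribution (DoubleCosetCode.code g)
        (DoubleCosetCode.N i n F - j) := by
  have : CharP F 2 := charP_of_injective_algebraMap (algebraMap (ZMod 2) F).injective 2
  refine DoubleCosetCode.weightDistribution_symm _ ?_ hj
  -- Among the admissible pairs, `2 ≤ n` fails only for `i = n = 1`.
  have h := DoubleCosetCode.sum_trace_DC g (by omega)
  change (fun k => algebraMap (ZMod 2) F ((1 : Fin _ → ZMod 2) k)) ⬝ᵥ
    DoubleCosetCode.traceVector g = 0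
  simpa [dotProduct, DoubleCosetCode.traceVector] using h
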